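/- Let $S\ge 2$ and $d\ge 1$ be integers with $S\mid d$, let $T\ge 0$ be an integer, and put $\alpha=1/S$, $\ell=d-d/S$ and $\varphi=T\log_2(d)/d$. Assume $\varphi\le\alpha$. For $s\in\{0,\dots,S-1\}$ let $\mathcal I(s)=\{s(d-\ell),\dots,(s+1)(d-\ell)-1\}\subset\{0,\dots,d-1\}$. For $k\in\{0,1\}^d$ let $$|\mu(k)\rangle=\frac1{\sqrt d}\sum_{j=0}^{d-1}(-1)^{k_j}|j\rangle\in\mathbb C^d ,$$ and let the signature of the symbol $s$ under the key $k$ be the substring of $k$ on the positions outside $\mathcal I(s)$. To verify an alleged signature $\kappa\in\{0,1\}^{\ell}$ of the symbol $t$, one performs on $|\mu(k)\rangle$ the projective measurement $\{|\psi\rangle\langle\psi|,\,1-|\psi\rangle\langle\psi|\}$ (outcomes $1$ and $0$), where $|\psi\rangle$ is the normalisation of the sum of all $|\mu(k')\rangle$, $k'\in\{0,1\}^d$, whose restriction to the positions outside $\mathcal I(t)$ equals $\kappa$. Let $t\neq s$, and let $k\in\{0,1\}^d$ be uniformly random. An attacker receives the signature of $s$ under $k$ together with $|\mu(k)\rangle^{\otimes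 T}$, performs an arbitrary quantum measurement (POVM, possibly depending on the signature received) and outputs an alleged signature $\kappa\in\{0,1\}^\ell$ of $t$; this is then verified on $|\mu(k)\rangle$. Let $J$ be the probability that the outcome of the verification is $0$. Then for every such attacker $$1-J\le p_1,\qquad p_1=(1-\alpha)\left[\left(1-\frac{\alpha}{1-\alpha}\,2h^{-1}\!\left(1-\frac{\varphi}{\alpha}\right)\right)^2+\sqrt{\frac83}\cdot\frac{\sqrt{d-\ell}}{\ell}\right],$$ where $h^{-1}:[0,1]\to[0,\tfrac12]$ is the inverse of the restriction to $[0,\tfrac12]$ of the binary entropy function $h(p)=p\log_2\frac1p+(1-p)\log_2\frac1{1-p}$. -/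

import Mathlib

noncomputable section

namespace QSig

open scoped BigOperators InnerProductSpace ComplexOrder

/-- Length `ℓ = d - d / S` of a revealed substring (for `S` dividing `d`). -/
def revealedLength (S d : ℕ) : ℕ := d - d / S

/-- The set `I(s) = {s (d - ℓ), …, (s + 1)(d - ℓ) - 1}` of positions of the private key that are
not revealed when the symbol `s` is signed. -/
def hidden (S d : ℕ) (s : Fin S) : Finset (Fin d) :=
  Finset.univ.filter fun j =>
    (s : ℕ) * (d - revealedLength S d) ≤ (j : ℕ) ∧
      (j : ℕ) < ((s : ℕ) + 1) * (d - revealedLength S d)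

/-- Strings `κ` of bits indexed by the positions outside `I(s)`: the possible signatures of the
symbol `s` on one qudit. -/
abbrev Signature (S d : ℕ) (s : Fin S) : Type := {j : Fin d // j ∉ hidden S d s} → Bool

/-- The genuine signature of the symbol `s` under the private key `k`: the substring of `k`
outside `I(s)`. -/
def sign {S d : ℕ} (k : Fin d → Bool) (s : Fin S) : Signature S d s := fun j => k j

/-- The fingerprinting state `|μ(k)⟩ = d^(-1/2) ∑ j, (-1)^(k j) |j⟩`, the public key of `k`. -/
def fingerprint {d : ℕ} (k : Fin d → Bool) : EuclideanSpace ℂ (Fin d) :=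
  WithLp.toLp 2 fun j => ((1 / Real.sqrt d : ℝ) : ℂ) * (if k j then -1 else 1)

/-- The state `|μ(k)⟩^{⊗ T}`, in the product basis of `(ℂ^d)^{⊗ T}` (indexed by
`Fin T → Fin d`). -/
def copies {d : ℕ} (T : ℕ) (k : Fin d → Bool) : EuclideanSpace ℂ (Fin T → Fin d) :=
  WithLp.toLp 2 fun i => ∏ a, fingerprint k (i a)

/-- The sum of all fingerprinting states that are consistent with the signature `κ` of `t`. -/
def verifVector {S d : ℕ} (t : Fin S) (κ : Signature S d t) : EuclideanSpace ℂ (Fin d) :=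
  ∑ k ∈ Finset.univ.filter (fun k : Fin d → Bool => sign k t = κ), fingerprint k

/-- The normalised state `|ψ⟩` onto which the verifier projects. -/
def verifState {S d : ℕ} (t : Fin S) (κ : Signature S d t) : EuclideanSpace ℂ (Fin d) :=
  ((‖verifVector t κ‖⁻¹ : ℝ) : ℂ) • verifVector t κ

/-- Probability that the projective measurement `{|ψ⟩⟨ψ|, 1 - |ψ⟩⟨ψ|}` that verifies the
signature `κ` of `t` gives the outcome `1` (accept) on the public key `|μ(k)⟩`. -/
def probOne {S d : ℕ} (t : Fin S) (κ : Signature S d t) (k : Fin d → Bool) : ℝ :=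
  ‖⟪verifState t κ, fingerprint k⟫_ℂ‖ ^ 2

/-- Probability of the complementary outcome `0` of that measurement. -/
def probZero {S d : ℕ} (t : Fin S) (κ : Signature S d t) (k : Fin d → Bool) : ℝ :=
  1 - probOne t κ k

/-- A quantum measurement (POVM) with outcomes in `Ω` on the space `ℂ^n`. -/
structure Povm (n Ω : Type) [Fintype n] [DecidableEq n] [Fintype Ω] where
  /-- the effect of each outcome -/
  effect : Ω → Matrix n n ℂ
  posSemidef : ∀ ω, (effect ω).PosSemidef
  sum_eq_one : ∑ ω, effect ω = 1

/-- Born rule: the probability of the outcome `ω` on the pure state `v`. -/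
def Povm.prob {n Ω : Type} [Fintype n] [DecidableEq n] [Fintype Ω] (M : Povm n Ω)
    (v : EuclideanSpace ℂ n) (ω : Ω) : ℝ :=
  (star v.ofLp ⬝ᵥ (M.effect ω).mulVec v.ofLp).re

/-- An attack on one qudit: having seen the genuine signature of the symbol `s`, the attacker
performs an arbitrary measurement (which may depend on that signature) on the `T` copies of the
public key; its outcome is the forged signature of `t`. -/
abbrev Attack (S d T : ℕ) (s t : Fin S) : Type :=
  Signature S d s → Povm (Fin T → Fin d) (Signature S d t)

/-- The per-qudit error probability `J` of the attack: for a uniformly random private key `k`, the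
probability that the verification of the forged signature on `|μ(k)⟩` gives the outcome `0`. -/
def errorProb {S d T : ℕ} {s t : Fin S} (A : Attack S d T s t) : ℝ :=
  (1 / 2 ^ d) * ∑ k : Fin d → Bool, ∑ κ : Signature S d t,
    (A (sign k s)).prob (copies T k) κ * probZero t κ k

/-- Binary entropy function, in bits. -/
def h (p : ℝ) : ℝ := p * Real.logb 2 (1 / p) + (1 - p) * Real.logb 2 (1 / (1 - p))

/-- The inverse of the restriction of `h` to `[0, 1/2]` (meaningful for arguments in `[0, 1]`). -/
def hInv (y : ℝ) : ℝ := Function.invFunOn h (Set.Icc 0 (1 / 2)) y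

/-- `α = 1 / S`. -/
def alpha (S : ℕ) : ℝ := 1 / S

/-- `φ = T (log₂ d) / d`. -/
def phi (d T : ℕ) : ℝ := T * Real.logb 2 d / d

/-- The bound `p₁` on the accept probability of a forged qudit. -/
def p1 (S d T : ℕ) : ℝ :=
  (1 - alpha S) *
    ((1 - alpha S / (1 - alpha S) * (2 * hInv (1 - phi d T / alpha S))) ^ 2 +
      Real.sqrt (8 / 3) *
        (Real.sqrt ((d : ℝ) - (revealedLength S d : ℝ)) / (revealedLength S d : ℝ)))

end QSig

end

open scoped BigOperators InnerProductSpace ComplexOrder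

namespace QSig

open Real

/-! Write m = d/S and ℓ = d - m. Averaging over the bits in I(t) kills those coordinates, so a
forgery κ is accepted with probability corr²/(dℓ), where corr is the correlation of the signs of κ
with those of k outside I(t). Split corr = a + b, with b the part over the m positions of I(s),
which the attacker has not seen. Then |a| ≤ ℓ - m, and everything rests on E[ab] and E[b²].

The quantum input is one inequality: an effect has probability at most its trace, and the traces of
a POVM on T qudits add up to d^T. Hence an exponential moment under the attack is at most d^T times
what guessing without copies allows, and Jensen turns this into E[g] ≤ T log d + log K
(`mean_le_log`). In `hInv` terms, T log d = m · rate w with w = 1 - 2h⁻¹(1 - φ/α).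

For E[ab] take g = r·a·b. The optimal r and the Legendre duality of log cosh with `rate` give E[ab]
≤ (ℓ - m)mw (`mean_mul_hiddenCorr_le`). For E[b²] take g = m · rate(|b|/m). Counting types gives K =
m + 1, and convexity of `rate` in the squared variable yields E[b²] ≤ (mw)² + 2m log(m + 1)
(`mean_hiddenCorr_sq_le`). The main terms form the square (ℓ - m + mw)²; the logarithm is absorbed
in the √(8/3) term. -/

/-! ### The rate function, its convexity and its Legendre dual -/

/-- The Cramér rate function of a fair sign. -/
noncomputable def rate (y : ℝ) : ℝ := log 2 - binEntropy ((1 - y) / 2)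

/-- The inverse hyperbolic tangent on `(-1, 1)`. -/
noncomputable def slope (y : ℝ) : ℝ := (log (1 + y) - log (1 - y)) / 2

lemma continuous_rate : Continuous rate := by
  unfold rate
  fun_prop

lemma rate_zero : rate 0 = 0 := by
  rw [rate, sub_zero, one_div, binEntropy_two_inv, sub_self]

lemma rate_eq {y : ℝ} (h₁ : -1 < y) (h₂ : y < 1) :
    rate y = y * slope y + (log (1 + y) + log (1 - y)) / 2 := by
  have e₁ : log ((1 - y) / 2) = log (1 - y) - log 2 := log_div (by linarith) (by norm_num)
  have e₂ : log (1 - (1 - y) / 2) = log (1 + y) - log 2 := by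
    rw [← log_div (by linarith) (by norm_num)]
    congr 1
    ring
  rw [rate, binEntropy, log_inv, log_inv, e₁, e₂, slope]
  ring

lemma hasDerivAt_rate {y : ℝ} (h₁ : -1 < y) (h₂ : y < 1) : HasDerivAt rate (slope y) y := by
  have e₁ : log ((1 - y) / 2) = log (1 - y) - log 2 := log_div (by linarith) (by norm_num)
  have e₂ : log (1 - (1 - y) / 2) = log (1 + y) - log 2 := by
    rw [← log_div (by linarith) (by norm_num)]
    congr 1
    ring
  have hin : HasDerivAt (fun y : ℝ => (1 - y) / 2) (-1 / 2) y :=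
    ((hasDerivAt_id y).const_sub 1).div_const 2
  have hb := (hasDerivAt_binEntropy (p := (1 - y) / 2) (by linarith) (by linarith)).comp y hin
  refine (hb.const_sub (log 2)).congr_deriv ?_
  rw [e₁, e₂, slope]
  ring

lemma hasSum_slope {y : ℝ} (h₁ : 0 ≤ y) (h₂ : y < 1) :
    HasSum (fun k : ℕ => 1 / (2 * (k : ℝ) + 1) * y ^ (2 * k + 1)) (slope y) := by
  have := (hasSum_log_sub_log_of_abs_lt_one (x := y) (by rwa [abs_of_nonneg h₁])).div_const 2
  have e : (fun k : ℕ => 1 / (2 * (k : ℝ) + 1) * y ^ (2 * k + 1)) =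
      fun k : ℕ => 2 * (1 / (2 * (k : ℝ) + 1)) * y ^ (2 * k + 1) / 2 := by
    funext k
    ring
  rw [e]
  exact this

lemma le_slope {y : ℝ} (h₁ : 0 ≤ y) (h₂ : y < 1) : y ≤ slope y := by
  have := le_hasSum (hasSum_slope h₁ h₂) 0 fun k _ => by positivity
  simpa using this

/-- `slope y / y` is increasing. -/
lemma slope_mul_le {y w : ℝ} (h₀ : 0 ≤ y) (h : y ≤ w) (hw : w < 1) :
    slope y * w ≤ slope w * y := by
  refine hasSum_le (fun k => ?_) ((hasSum_slope h₀ (h.trans_lt hw)).mul_right w)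
    ((hasSum_slope (h₀.trans h) hw).mul_right y)
  have := pow_le_pow_left₀ h₀ h (2 * k)
  have h2 : y ^ (2 * k) * (y * w) ≤ w ^ (2 * k) * (y * w) :=
    mul_le_mul_of_nonneg_right this (mul_nonneg h₀ (h₀.trans h))
  calc 1 / (2 * (k : ℝ) + 1) * y ^ (2 * k + 1) * w
      = 1 / (2 * (k : ℝ) + 1) * (y ^ (2 * k) * (y * w)) := by ring
    _ ≤ 1 / (2 * (k : ℝ) + 1) * (w ^ (2 * k) * (y * w)) := by gcongr
    _ = _ := by ring

/-- The rate function is convex as a function of the square of its argument. -/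
lemma exists_rate_tangent {w : ℝ} (h₀ : 0 ≤ w) (h₁ : w < 1) :
    ∃ c : ℝ, 1 / 2 ≤ c ∧ ∀ y, 0 ≤ y → y ≤ 1 → rate w + c * (y ^ 2 - w ^ 2) ≤ rate y := by
  obtain ⟨c, hc, hlo, hhi⟩ : ∃ c : ℝ, 1 / 2 ≤ c ∧ (∀ y, 0 ≤ y → y ≤ w → slope y ≤ 2 * c * y) ∧
      ∀ y, w ≤ y → y < 1 → 2 * c * y ≤ slope y := by
    rcases h₀.eq_or_lt with rfl | hw
    -- The limit of `slope w / (2 * w)` as w tends to 0.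
    · refine ⟨1 / 2, le_rfl, fun y hy hy' => ?_, fun y hy hy' => ?_⟩
      · obtain rfl := le_antisymm hy' hy
        simp [slope]
      · simpa using le_slope hy hy'
    · have e : ∀ y, 2 * (slope w / (2 * w)) * y = slope w * y / w := fun y => by field_simp
      refine ⟨slope w / (2 * w), ?_, fun y hy hy' => ?_, fun y hy hy' => ?_⟩
      · rw [le_div_iff₀ (by linarith)]
        linarith [le_slope h₀ h₁]
      · rw [e, le_div_iff₀ hw]
        exact slope_mul_le hy hy' h₁
      · rw [e, div_le_iff₀ hw]
        exact slope_mul_le h₀ hy hy'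
  have hcont : Continuous fun y => rate y - c * y ^ 2 := continuous_rate.sub (by fun_prop)
  have hder : ∀ y, 0 ≤ y → y < 1 →
      HasDerivAt (fun y => rate y - c * y ^ 2) (slope y - 2 * c * y) y := fun y hy hy' =>
    ((hasDerivAt_rate (by linarith) hy').sub ((hasDerivAt_pow 2 y).const_mul c)).congr_deriv
      (by norm_num; ring)
  refine ⟨c, hc, fun y hy hy' => ?_⟩
  rcases le_total y w with hyw | hyw
  · have := antitoneOn_of_deriv_nonpos (convex_Icc 0 w) hcont.continuousOn
      (fun x hx => by
        rw [interior_Icc] at hx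
        exact (hder x hx.1.le (hx.2.trans h₁)).differentiableAt.differentiableWithinAt)
      (fun x hx => by
        rw [interior_Icc] at hx
        rw [(hder x hx.1.le (hx.2.trans h₁)).deriv]
        linarith [hlo x hx.1.le hx.2.le]) ⟨hy, hyw⟩ ⟨h₀, le_rfl⟩ hyw
    simp only at this
    linarith
  · have := monotoneOn_of_deriv_nonneg (convex_Icc w 1) hcont.continuousOn
      (fun x hx => by
        rw [interior_Icc] at hx
        exact (hder x (h₀.trans hx.1.le) hx.2).differentiableAt.differentiableWithinAt)
      (fun x hx => by
        rw [interior_Icc] at hx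
        rw [(hder x (h₀.trans hx.1.le) hx.2).deriv]
        linarith [hhi x hx.1.le hx.2]) ⟨le_rfl, h₁.le⟩ ⟨hyw, hy'⟩ hyw
    simp only at this
    linarith

/-- Legendre duality: log cosh is the conjugate of `rate`, and its supremum is attained at w when
the dual variable is artanh w. -/
lemma log_cosh_slope {w : ℝ} (h₁ : -1 < w) (h₂ : w < 1) :
    log (cosh (slope w)) = w * slope w - rate w := by
  have hp : exp (log (1 + w) / 2) ^ 2 = 1 + w := by
    rw [← exp_nat_mul, Nat.cast_ofNat, mul_div_cancel₀ _ two_ne_zero, exp_log (by linarith)]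
  have hq : exp (log (1 - w) / 2) ^ 2 = 1 - w := by
    rw [← exp_nat_mul, Nat.cast_ofNat, mul_div_cancel₀ _ two_ne_zero, exp_log (by linarith)]
  have : cosh (slope w) = exp (-((log (1 + w) + log (1 - w)) / 2)) := by
    have e : slope w = log (1 + w) / 2 - log (1 - w) / 2 := by rw [slope]; ring
    rw [cosh_eq, e, add_div (log (1 + w)), exp_neg, exp_neg, exp_sub, exp_add]
    have := exp_pos (log (1 + w) / 2)
    have := exp_pos (log (1 - w) / 2)
    field_simp
    linarith
  rw [this, log_exp, rate_eq h₁ h₂]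
  ring

/-! ### Numerical estimate, Jensen's inequality, inverse entropy -/

/-- The source of the constant √(8/3) in `p1`. The inequality is tight to within about 2% for m = 3,
4, 5, hence the explicit checks. -/
lemma two_mul_log_succ_le (m : ℕ) : 2 * log (m + 1) ≤ √(8 / 3) * √m := by
  rw [← sqrt_mul (by norm_num)]
  have l2 := log_two_lt_d9
  have l3 : log 3 ≤ 8 / 5 * log 2 := by
    have : log ((3 : ℝ) ^ 5) ≤ log ((2 : ℝ) ^ 8) := log_le_log (by norm_num) (by norm_num)
    rw [log_pow, log_pow] at this
    push_cast at this
    linarith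
  have l5 : log 5 ≤ 7 / 3 * log 2 := by
    have : log ((5 : ℝ) ^ 3) ≤ log ((2 : ℝ) ^ 7) := log_le_log (by norm_num) (by norm_num)
    rw [log_pow, log_pow] at this
    push_cast at this
    linarith
  have l4 : log 4 = 2 * log 2 := by
    rw [show (4 : ℝ) = 2 ^ 2 by norm_num, log_pow]; norm_num
  have l6 : log 6 = log 2 + log 3 := by
    rw [← log_mul (by norm_num) (by norm_num)]; norm_num
  rcases le_or_gt m 4 with hm | hm
  · apply le_sqrt_of_sq_le
    have key : ∀ x y z : ℝ, 0 ≤ x → x ≤ y → (2 * y) ^ 2 ≤ z → (2 * x) ^ 2 ≤ z :=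
      fun x y z hx hxy h => le_trans (by gcongr) h
    interval_cases m
    · simp
    · refine key _ 0.694 _ (log_nonneg (by norm_num)) ?_ (by norm_num)
      norm_num; linarith
    · refine key _ 1.11 _ (log_nonneg (by norm_num)) ?_ (by norm_num)
      norm_num; linarith
    · refine key _ 1.387 _ (log_nonneg (by norm_num)) ?_ (by norm_num)
      norm_num; linarith
    · refine key _ 1.62 _ (log_nonneg (by norm_num)) ?_ (by norm_num)
      norm_num; linarith
  · induction m, hm using Nat.le_induction with
    | base =>
      apply le_sqrt_of_sq_le
      have : (0 : ℝ) ≤ log 6 := log_nonneg (by norm_num)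
      norm_num
      nlinarith
    | succ m hm ih =>
      have hm' : (5 : ℝ) ≤ m := by exact_mod_cast hm
      have hlog : log ((m + 1 : ℕ) + 1) ≤ log (m + 1) + 1 / (m + 1) := by
        have h := log_le_sub_one_of_pos (x := ((m : ℝ) + 1 + 1) / (m + 1)) (by positivity)
        rw [log_div (by positivity) (by positivity)] at h
        have e : ((m : ℝ) + 1 + 1) / (m + 1) - 1 = 1 / (m + 1) := by field_simp; ring
        push_cast
        linarith
      have hs : √(8 / 3 * m) + 2 / (m + 1) ≤ √(8 / 3 * (m + 1 : ℕ)) := by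
        push_cast
        set u := √(8 / 3 * (m : ℝ))
        set v := √(8 / 3 * ((m : ℝ) + 1))
        have hu : u ^ 2 = 8 / 3 * m := sq_sqrt (by positivity)
        have hv : v ^ 2 = 8 / 3 * (m + 1) := sq_sqrt (by positivity)
        -- The increment v - u ≥ 4/(3v) beats 2/(m + 1) = 16/(3v²) once v ≥ 4, which is m ≥ 5; hence
        -- the start of the induction.
        have hv0 : 4 ≤ v := le_sqrt_of_sq_le (by linarith)
        have hu0 : 0 ≤ u := sqrt_nonneg _
        have huv : u ≤ v := sqrt_le_sqrt (by linarith)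
        rw [← le_sub_iff_add_le', div_le_iff₀ (by positivity)]
        have e : (m : ℝ) + 1 = 3 / 8 * v ^ 2 := by rw [hv]; ring
        rw [e]
        have h1 : (v - u) * (v + u) = 8 / 3 := by linear_combination hv - hu
        have h2 : (v - u) * (2 * v) ≥ 8 / 3 := by nlinarith
        nlinarith
      have e : 2 / ((m : ℝ) + 1) = 2 * (1 / (m + 1)) := by ring
      linarith

lemma exp_weighted_le {ι : Type*} (s : Finset ι) (p g : ι → ℝ) (hp : ∀ i ∈ s, 0 ≤ p i)
    (hp1 : ∑ i ∈ s, p i = 1) {K : ℝ} (hK : 0 < K) (h : ∑ i ∈ s, p i * exp (g i) ≤ K) :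
    ∑ i ∈ s, p i * g i ≤ log K := by
  have hle : exp (∑ i ∈ s, p i • g i) ≤ ∑ i ∈ s, p i • exp (g i) :=
    convexOn_exp.map_sum_le hp hp1 fun _ _ => Set.mem_univ _
  rw [le_log_iff_exp_le hK]
  exact hle.trans h

/-- `h` is the binary entropy in bits, `Real.binEntropy` the one in nats. -/
lemma h_mul_log_two (p : ℝ) : h p * log 2 = binEntropy p := by
  have : log 2 ≠ 0 := (log_pos one_lt_two).ne'
  rw [h, binEntropy, logb, logb, one_div, one_div]
  field_simp

/-- The intermediate value theorem is enough: any preimage in [0, 1/2] serves, so monotonicity of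
`h` is not used. -/
lemma hInv_spec {y : ℝ} (h₀ : 0 ≤ y) (h₁ : y ≤ 1) :
    hInv y ∈ Set.Icc (0 : ℝ) (1 / 2) ∧ h (hInv y) = y := by
  have l2 : 0 < log 2 := log_pos one_lt_two
  have he : h = fun p => binEntropy p / log 2 := by
    funext p
    rw [← h_mul_log_two, mul_div_cancel_right₀ _ l2.ne']
  have hc : Continuous h := by
    rw [he]
    fun_prop
  have hi := intermediate_value_Icc (a := (0 : ℝ)) (b := 1 / 2) (by norm_num) hc.continuousOn
  have hmem : y ∈ h '' Set.Icc 0 (1 / 2) := by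
    apply hi
    rw [he]
    simp only [binEntropy_zero, zero_div, one_div, binEntropy_two_inv, div_self l2.ne']
    exact ⟨h₀, h₁⟩
  exact ⟨Function.invFunOn_mem hmem, Function.invFunOn_eq hmem⟩

/-! ### Born probabilities and traces of effects -/

lemma star_dotProduct_self {n : Type} [Fintype n] (v : EuclideanSpace ℂ n) :
    star v.ofLp ⬝ᵥ v.ofLp = ((‖v‖ ^ 2 : ℝ) : ℂ) := by
  rw [EuclideanSpace.norm_sq_eq, dotProduct]
  push_cast
  refine Finset.sum_congr rfl fun i _ => ?_
  simpa using Complex.conj_mul' (v.ofLp i)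

section Measurement

variable {n Ω : Type} [Fintype n] [DecidableEq n] [Fintype Ω]

lemma Povm.prob_nonneg (M : Povm n Ω) (v : EuclideanSpace ℂ n) (ω : Ω) : 0 ≤ M.prob v ω :=
  (Complex.nonneg_iff.mp ((M.posSemidef ω).dotProduct_mulVec_nonneg v.ofLp)).1

lemma Povm.sum_prob (M : Povm n Ω) {v : EuclideanSpace ℂ n} (hv : ‖v‖ = 1) :
    ∑ ω, M.prob v ω = 1 := by
  simp only [Povm.prob]
  rw [← Complex.re_sum, ← dotProduct_sum, ← Matrix.sum_mulVec, M.sum_eq_one, Matrix.one_mulVec,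
    star_dotProduct_self, hv]
  simp

lemma Povm.sum_trace (M : Povm n Ω) : ∑ ω, (M.effect ω).trace.re = Fintype.card n := by
  rw [← Complex.re_sum, ← Matrix.trace_sum, M.sum_eq_one, Matrix.trace_one]
  simp

/-- With P the projector onto v, the difference of the two sides is the trace of the positive matrix
(1 - P)E(1 - P). -/
lemma Povm.prob_le_trace (M : Povm n Ω) {v : EuclideanSpace ℂ n} (hv : ‖v‖ = 1) (ω : Ω) :
    M.prob v ω ≤ (M.effect ω).trace.re := by
  set E := M.effect ω with hE
  set P : Matrix n n ℂ := Matrix.vecMulVec v.ofLp (star v.ofLp) with hP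
  have hv1 : star v.ofLp ⬝ᵥ v.ofLp = 1 := by rw [star_dotProduct_self, hv]; simp
  have hPh : P.conjTranspose = P := by simp [hP, Matrix.conjTranspose_vecMulVec]
  have hPP : P * P = P := by
    rw [hP, Matrix.vecMulVec_mul_vecMulVec, hv1]
    simp
  have htr : (E * P).trace = star v.ofLp ⬝ᵥ E.mulVec v.ofLp := by
    rw [hP, Matrix.mul_vecMulVec, Matrix.trace_vecMulVec, dotProduct_comm]
  have h0 := ((M.posSemidef ω).conjTranspose_mul_mul_same (1 - P)).trace_nonneg
  rw [← hE, Matrix.conjTranspose_sub, Matrix.conjTranspose_one, hPh, Matrix.trace_mul_cycle,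
    sub_mul, one_mul, mul_sub, mul_one, hPP, sub_self, sub_zero, Matrix.trace_mul_comm, mul_sub,
    mul_one, Matrix.trace_sub, htr] at h0
  have := (Complex.nonneg_iff.mp h0).1
  rw [Complex.sub_re] at this
  rw [Povm.prob, ← hE]
  linarith

end Measurement

/-! ### Keys sharing a signature, and the accept probability -/

/-- The sign `(-1) ^ b`. -/
def chi (b : Bool) : ℝ := if b then -1 else 1

lemma chi_sq (b : Bool) : chi b ^ 2 = 1 := by cases b <;> simp [chi]

variable {S d : ℕ}

lemma fingerprint_apply (k : Fin d → Bool) (j : Fin d) :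
    fingerprint k j = ((chi (k j) / √d : ℝ) : ℂ) := by
  rw [fingerprint, chi]
  cases hk : k j <;> simp [hk, div_eq_mul_inv]

lemma norm_copies (hd : 0 < d) (T : ℕ) (k : Fin d → Bool) : ‖copies T k‖ = 1 := by
  have hd' : (0 : ℝ) < d := by exact_mod_cast hd
  rw [← sq_eq_sq₀ (norm_nonneg _) zero_le_one, EuclideanSpace.norm_sq_eq]
  have : ∀ i : Fin T → Fin d, ‖copies T k i‖ ^ 2 = (1 / d : ℝ) ^ T := fun i => by
    simp only [copies, fingerprint_apply, norm_prod, Complex.norm_real, norm_eq_abs,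
      ← Finset.prod_pow, sq_abs, div_pow, chi_sq, sq_sqrt hd'.le, Finset.prod_const,
      Finset.card_univ, Fintype.card_fin]
  simp only [this]
  simp [hd'.ne']

/-- The keys with a given signature of `s` are a product set. -/
lemma sum_fibre_prod {R : Type*} [CommSemiring R] (s : Fin S) (σ : Signature S d s)
    (F : Fin d → Bool → R) :
    ∑ k : Fin d → Bool with sign k s = σ, ∏ j, F j (k j) =
      ∏ j, if hj : j ∈ hidden S d s then F j true + F j false else F j (σ ⟨j, hj⟩) := by
  classical
  have e : Finset.univ.filter (fun k : Fin d → Bool => sign k s = σ) =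
      Fintype.piFinset fun j => if hj : j ∈ hidden S d s then Finset.univ else {σ ⟨j, hj⟩} := by
    ext k
    simp only [Finset.mem_filter, Finset.mem_univ, true_and, Fintype.mem_piFinset, sign,
      funext_iff, Subtype.forall]
    refine forall_congr' fun j => ?_
    by_cases hj : j ∈ hidden S d s <;> simp [hj]
  rw [e, ← Finset.prod_univ_sum]
  refine Finset.prod_congr rfl fun j _ => ?_
  by_cases hj : j ∈ hidden S d s <;> simp [hj]

lemma sum_fibre_prod_hidden (s : Fin S) (σ : Signature S d s) (F : Fin d → Bool → ℝ) :
    ∑ k : Fin d → Bool with sign k s = σ, ∏ j ∈ hidden S d s, F j (k j) =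
      ∏ j ∈ hidden S d s, (F j true + F j false) := by
  have := sum_fibre_prod s σ fun j b => if j ∈ hidden S d s then F j b else 1
  simp only [Finset.prod_ite_mem, Finset.univ_inter] at this
  rw [this, ← Finset.prod_subset (Finset.subset_univ (hidden S d s)) fun j _ hj => by simp [hj]]
  exact Finset.prod_congr rfl fun j hj => by simp [hj]

lemma card_fibre (s : Fin S) (σ : Signature S d s) :
    (Finset.univ.filter fun k : Fin d → Bool => sign k s = σ).card =
      2 ^ (hidden S d s).card := by
  have := sum_fibre_prod_hidden s σ fun _ _ => 1
  simp only [Finset.prod_const_one, Finset.sum_const, nsmul_eq_mul, mul_one, Finset.prod_const]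
    at this
  norm_num at this
  exact_mod_cast this

/-- The signs of a signature, extended by zero to the hidden positions. -/
def signVector (t : Fin S) (κ : Signature S d t) (j : Fin d) : ℝ :=
  if hj : j ∈ hidden S d t then 0 else chi (κ ⟨j, hj⟩)

lemma signVector_sq (t : Fin S) (κ : Signature S d t) {j : Fin d} (hj : j ∉ hidden S d t) :
    signVector t κ j ^ 2 = 1 := by
  rw [signVector, dif_neg hj, chi_sq]

lemma sum_signVector_sq (t : Fin S) (κ : Signature S d t) :
    ∑ j, signVector t κ j ^ 2 = ((hidden S d t)ᶜ.card : ℝ) := by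
  rw [← Finset.sum_compl_add_sum (hidden S d t),
    Finset.sum_congr rfl fun j hj => signVector_sq t κ (Finset.mem_compl.mp hj),
    Finset.sum_eq_zero (s := hidden S d t) fun j hj => by simp [signVector, hj]]
  simp

/-- A hidden bit takes both values equally often, so its signs cancel; a revealed bit is constant
over the sum. -/
lemma verifVector_eq (t : Fin S) (κ : Signature S d t) :
    verifVector t κ = ((2 ^ (hidden S d t).card / √d : ℝ) : ℂ) •
      WithLp.toLp 2 fun j => (signVector t κ j : ℂ) := by
  classical
  have key : ∀ i, ∑ k : Fin d → Bool with sign k t = κ, chi (k i) =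
      2 ^ (hidden S d t).card * signVector t κ i := by
    intro i
    by_cases hi : i ∈ hidden S d t
    · have := sum_fibre_prod t κ fun j b => if j = i then chi b else (1 : ℝ)
      simp only [Finset.prod_ite_eq', Finset.mem_univ, if_true] at this
      rw [this, signVector, dif_pos hi, mul_zero]
      refine Finset.prod_eq_zero (Finset.mem_univ i) ?_
      simp [hi, chi]
    · rw [signVector, dif_neg hi, Finset.sum_congr rfl (g := fun _ => chi (κ ⟨i, hi⟩)),
        Finset.sum_const, card_fibre, nsmul_eq_mul]
      · push_cast
        rfl
      · intro k hk
        rw [← (Finset.mem_filter.mp hk).2]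
        rfl
  ext i
  rw [verifVector, WithLp.ofLp_sum, Finset.sum_apply]
  simp only [fingerprint_apply, PiLp.smul_apply, smul_eq_mul]
  rw [← Complex.ofReal_sum, ← Finset.sum_div, key, ← Complex.ofReal_mul]
  congr 1
  ring

/-- The correlation of a signature of `t` with a key on the revealed positions. -/
def corr (t : Fin S) (κ : Signature S d t) (k : Fin d → Bool) : ℝ :=
  ∑ j, signVector t κ j * chi (k j)

lemma probOne_eq (hd : 0 < d) (t : Fin S) (κ : Signature S d t) (k : Fin d → Bool) :
    probOne t κ k = corr t κ k ^ 2 / (d * (hidden S d t)ᶜ.card) := by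
  have hd' : (0 : ℝ) < d := by exact_mod_cast hd
  set u : EuclideanSpace ℂ (Fin d) := WithLp.toLp 2 fun j => (signVector t κ j : ℂ) with hu
  set c : ℝ := 2 ^ (hidden S d t).card / √d with hc
  have hc0 : 0 < c := by positivity
  have hun : ‖u‖ ^ 2 = ((hidden S d t)ᶜ.card : ℝ) := by
    rw [EuclideanSpace.norm_sq_eq, ← sum_signVector_sq t κ]
    refine Finset.sum_congr rfl fun j _ => ?_
    simp [hu]
  have hin : ⟪u, fingerprint k⟫_ℂ = ((corr t κ k / √d : ℝ) : ℂ) := by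
    rw [PiLp.inner_apply, corr, Finset.sum_div, Complex.ofReal_sum]
    refine Finset.sum_congr rfl fun j _ => ?_
    rw [fingerprint_apply, hu]
    simp only [RCLike.inner_apply, Complex.conj_ofReal]
    push_cast
    ring
  rw [probOne, verifState, verifVector_eq, ← hu, ← hc, inner_smul_left, inner_smul_left, hin,
    norm_smul, norm_mul, norm_mul, Complex.conj_ofReal, Complex.conj_ofReal, Complex.norm_real,
    Complex.norm_real, Complex.norm_real]
  simp only [norm_eq_abs, mul_pow, sq_abs, div_pow, sq_sqrt hd'.le, mul_inv, inv_pow, hun]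
  field_simp

/-! ### Exponential moments over the hidden bits -/

lemma sum_fibre_exp {s : Fin S} {v : Fin d → ℝ} (σ : Signature S d s) (hv : ∀ j ∈ hidden S d s, v j ^ 2 = 1) (r : ℝ) :
    ∑ k : Fin d → Bool with sign k s = σ, exp (r * ∑ j ∈ hidden S d s, v j * chi (k j)) =
      2 ^ (hidden S d s).card * cosh r ^ (hidden S d s).card := by
  simp only [Finset.mul_sum, exp_sum]
  rw [sum_fibre_prod_hidden s σ fun j b => exp (r * (v j * chi b)), ← mul_pow]
  refine Finset.prod_eq_pow_card fun j hj => ?_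
  rw [cosh_eq]
  rcases mul_self_eq_one_iff.mp ((sq (v j)).symm.trans (hv j hj)) with h | h <;> simp [h, chi] <;> ring

/-- The likelihood of a string of length m with D ones under its own empirical law; D = 0 and D = m
are split off to avoid log 0. -/
lemma exp_neg_mul_binEntropy {m D : ℕ} (hm : 0 < m) (hD : D ≤ m) :
    exp (-(m * binEntropy (D / m))) = ((D : ℝ) / m) ^ D * (1 - (D : ℝ) / m) ^ (m - D) := by
  have hm' : (0 : ℝ) < m := by exact_mod_cast hm
  rcases Nat.eq_zero_or_pos D with rfl | h0
  · simp
  rcases hD.eq_or_lt with rfl | h1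
  · simp [hm'.ne']
  have h0' : (0 : ℝ) < D := by exact_mod_cast h0
  have h1' : (D : ℝ) < m := by exact_mod_cast h1
  have hp : 0 < (D : ℝ) / m := by positivity
  have hq : 0 < 1 - (D : ℝ) / m := by
    rw [sub_pos, div_lt_one hm']
    exact h1'
  rw [← exp_log (pow_pos hp D), ← exp_log (pow_pos hq (m - D)), ← exp_add, log_pow, log_pow,
    Nat.cast_sub hD, binEntropy, log_inv, log_inv]
  congr 1
  field_simp
  ring

lemma rate_abs (y : ℝ) : rate |y| = rate y := by
  rcases abs_choice y with h | h <;> rw [h]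
  rw [rate, rate, ← binEntropy_one_sub]
  congr 2
  ring

/-- Method of types: if D of the m signs are -1, the exponential is 2^m times the likelihood of the
pattern under bias D/m. Bounding it by the sum over all m + 1 biases removes the dependence on the
key, and each bias has total mass 1 on a fibre. -/
lemma sum_fibre_exp_rate {s : Fin S} {v : Fin d → ℝ} (σ : Signature S d s) {m : ℕ} (hm : 0 < m)
    (hcard : (hidden S d s).card = m) (hv : ∀ j ∈ hidden S d s, v j ^ 2 = 1) :
    ∑ k : Fin d → Bool with sign k s = σ,
      exp (m * rate (|∑ j ∈ hidden S d s, v j * chi (k j)| / m)) ≤ 2 ^ m * (m + 1) := by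
  classical
  have hm' : (0 : ℝ) < m := by exact_mod_cast hm
  set q : ℕ → ℝ → ℝ := fun D x => if x = -1 then (D : ℝ) / m else 1 - (D : ℝ) / m with hq
  have hpm : ∀ j ∈ hidden S d s, v j = 1 ∨ v j = -1 := fun j hj =>
    mul_self_eq_one_iff.mp ((sq (v j)).symm.trans (hv j hj))
  have hq0 : ∀ D ≤ m, ∀ x, 0 ≤ q D x := by
    intro D hD x
    have h1 : (D : ℝ) / m ≤ 1 := by
      rw [div_le_one hm']
      exact_mod_cast hD
    simp only [hq]
    split_ifs
    · positivity
    · linarith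
  have key : ∀ k : Fin d → Bool,
      exp (m * rate (|∑ j ∈ hidden S d s, v j * chi (k j)| / m)) ≤
        2 ^ m * ∑ D ∈ Finset.range (m + 1), ∏ j ∈ hidden S d s, q D (v j * chi (k j)) := by
    intro k
    set J := (hidden S d s).filter fun j => v j * chi (k j) = -1 with hJ
    set J' := (hidden S d s).filter fun j => ¬ v j * chi (k j) = -1 with hJ'
    have hc : J.card + J'.card = m := by
      rw [← hcard]
      exact Finset.card_filter_add_card_filter_not _
    have hJm : J.card ≤ m := by omega
    have hsum : ∑ j ∈ hidden S d s, v j * chi (k j) = m - 2 * J.card := by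
      have e : ∀ j ∈ hidden S d s, v j * chi (k j) = if v j * chi (k j) = -1 then -1 else 1 := by
        intro j hj
        rcases hpm j hj with h | h <;> cases hk : k j <;> norm_num [h, chi]
      rw [Finset.sum_congr rfl e, Finset.sum_ite, Finset.sum_const, Finset.sum_const, ← hJ, ← hJ',
        ← hc]
      push_cast
      simp only [nsmul_eq_mul]
      ring
    have hprod : ∏ j ∈ hidden S d s, q J.card (v j * chi (k j)) =
        exp (-(m * binEntropy (J.card / m))) := by
      rw [exp_neg_mul_binEntropy hm hJm]
      simp only [hq]
      rw [Finset.prod_ite, Finset.prod_const, Finset.prod_const, ← hJ, ← hJ',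
        show m - J.card = J'.card by omega]
    have hexp : exp (m * rate (|∑ j ∈ hidden S d s, v j * chi (k j)| / m)) =
        2 ^ m * ∏ j ∈ hidden S d s, q J.card (v j * chi (k j)) := by
      have e1 : |∑ j ∈ hidden S d s, v j * chi (k j)| / m =
          |(∑ j ∈ hidden S d s, v j * chi (k j)) / m| := by rw [abs_div, abs_of_pos hm']
      have e2 : (1 - ((m : ℝ) - 2 * J.card) / m) / 2 = J.card / m := by field_simp; ring
      have e3 : (2 : ℝ) ^ m = exp (m * log 2) := by rw [exp_nat_mul, exp_log two_pos]
      rw [e1, rate_abs, hprod, hsum, rate, e2, e3, ← exp_add]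
      congr 1
      ring
    rw [hexp]
    refine mul_le_mul_of_nonneg_left ?_ (by positivity)
    exact Finset.single_le_sum
      (f := fun D => ∏ j ∈ hidden S d s, q D (v j * chi (k j)))
      (fun D hD => Finset.prod_nonneg fun j _ =>
        hq0 D (Nat.lt_succ_iff.mp (Finset.mem_range.mp hD)) _)
      (Finset.mem_range.mpr (Nat.lt_succ_iff.mpr hJm))
  refine (Finset.sum_le_sum fun k _ => key k).trans ?_
  rw [← Finset.mul_sum, Finset.sum_comm]
  refine mul_le_mul_of_nonneg_left ?_ (by positivity)
  have : ∀ D ∈ Finset.range (m + 1), ∑ k : Fin d → Bool with sign k s = σ,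
      ∏ j ∈ hidden S d s, q D (v j * chi (k j)) = 1 := by
    intro D _
    rw [sum_fibre_prod_hidden s σ fun j b => q D (v j * chi b)]
    refine Finset.prod_eq_one fun j hj => ?_
    rcases hpm j hj with h | h <;> norm_num [h, chi, hq]
  rw [Finset.sum_congr rfl this]
  simp

/-! ### Sizes and disjointness of the hidden blocks -/

lemma card_hidden (hSd : S ∣ d) (s : Fin S) : (hidden S d s).card = d / S := by
  obtain ⟨m, rfl⟩ := hSd
  have hS : 0 < S := s.pos
  have hm : S * m / S = m := Nat.mul_div_cancel_left m hS
  have hmd : m ≤ S * m := Nat.le_mul_of_pos_left m hS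
  have e : S * m - revealedLength S (S * m) = m := by
    rw [revealedLength, hm]
    omega
  have hs : ((s : ℕ) + 1) * m ≤ S * m := Nat.mul_le_mul_right m s.isLt
  rw [hm, hidden, e]
  have hmap : (Finset.univ.filter fun j : Fin (S * m) =>
      (s : ℕ) * m ≤ (j : ℕ) ∧ (j : ℕ) < ((s : ℕ) + 1) * m).map Fin.valEmbedding =
      Finset.Ico ((s : ℕ) * m) (((s : ℕ) + 1) * m) := by
    ext x
    simp only [Finset.mem_map, Finset.mem_filter, Finset.mem_univ, true_and, Finset.mem_Ico,
      Fin.valEmbedding_apply]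
    exact ⟨fun ⟨j, hj, hx⟩ => hx ▸ hj, fun hx => ⟨⟨x, hx.2.trans_le hs⟩, hx, rfl⟩⟩
  rw [← Finset.card_map Fin.valEmbedding, hmap, Nat.card_Ico, add_mul, one_mul]
  omega

lemma disjoint_hidden {s t : Fin S} (hst : t ≠ s) : Disjoint (hidden S d s) (hidden S d t) := by
  rw [Finset.disjoint_left]
  intro j hs ht
  simp only [hidden, Finset.mem_filter, Finset.mem_univ, true_and] at hs ht
  set m := d - revealedLength S d
  rcases lt_or_gt_of_ne (Fin.val_ne_of_ne hst) with h | h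
  · have : ((t : ℕ) + 1) * m ≤ s * m := Nat.mul_le_mul_right m h
    omega
  · have : ((s : ℕ) + 1) * m ≤ t * m := Nat.mul_le_mul_right m h
    omega

/-! ### Expectations under an attack -/

section Mean

variable {T : ℕ} {s t : Fin S}

/-- The expectation of a function of the key and of the forged signature. -/
noncomputable def mean (A : Attack S d T s t) (g : (Fin d → Bool) → Signature S d t → ℝ) : ℝ :=
  (1 / 2 ^ d) * ∑ k : Fin d → Bool, ∑ κ : Signature S d t,
    (A (sign k s)).prob (copies T k) κ * g k κ

variable (A : Attack S d T s t)

lemma mean_mono {f g : (Fin d → Bool) → Signature S d t → ℝ} (h : ∀ k κ, f k κ ≤ g k κ) :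
    mean A f ≤ mean A g := by
  refine mul_le_mul_of_nonneg_left ?_ (by positivity)
  exact Finset.sum_le_sum fun k _ => Finset.sum_le_sum fun κ _ =>
    mul_le_mul_of_nonneg_left (h k κ) (Povm.prob_nonneg _ _ _)

lemma mean_add (f g : (Fin d → Bool) → Signature S d t → ℝ) :
    mean A (fun k κ => f k κ + g k κ) = mean A f + mean A g := by
  simp only [mean, mul_add, Finset.sum_add_distrib]

lemma mean_mul (c : ℝ) (g : (Fin d → Bool) → Signature S d t → ℝ) :
    mean A (fun k κ => c * g k κ) = c * mean A g := by
  simp only [mean, Finset.mul_sum]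
  exact Finset.sum_congr rfl fun k _ => Finset.sum_congr rfl fun κ _ => by ring

lemma mean_const (hd : 0 < d) (c : ℝ) : mean A (fun _ _ => c) = c := by
  have : ∀ k : Fin d → Bool, ∑ κ, (A (sign k s)).prob (copies T k) κ * c = c := fun k => by
    rw [← Finset.sum_mul, Povm.sum_prob _ (norm_copies hd T k), one_mul]
  simp only [mean, this]
  simp

/-- A forgery has at most `d ^ T` times the weight it would have with no copies at all. -/
lemma mean_le_log (hd : 0 < d) {g : (Fin d → Bool) → Signature S d t → ℝ} {K : ℝ} (hK : 0 < K)
    (hg : ∀ σ κ, ∑ k : Fin d → Bool with sign k s = σ, exp (g k κ) ≤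
      2 ^ (hidden S d s).card * K) :
    mean A g ≤ T * log d + log K := by
  classical
  have hd' : (0 : ℝ) < d := by exact_mod_cast hd
  have hmean : ∀ f : (Fin d → Bool) → Signature S d t → ℝ, mean A f =
      ∑ x : (Fin d → Bool) × Signature S d t,
        (1 / 2 ^ d * (A (sign x.1 s)).prob (copies T x.1) x.2) * f x.1 x.2 := by
    intro f
    rw [Fintype.sum_prod_type, mean, Finset.mul_sum]
    refine Finset.sum_congr rfl fun k _ => ?_
    rw [Finset.mul_sum]
    exact Finset.sum_congr rfl fun κ _ => by ring
  have hexp : mean A (fun k κ => exp (g k κ)) ≤ d ^ T * K := by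
    -- The trace depends on the key only through its signature, so within a fibre it factors out and
    -- `hg` applies to each κ separately.
    have h1 : ∑ k : Fin d → Bool, ∑ κ : Signature S d t,
        (A (sign k s)).prob (copies T k) κ * exp (g k κ) ≤
        ∑ k : Fin d → Bool, ∑ κ : Signature S d t,
        ((A (sign k s)).effect κ).trace.re * exp (g k κ) :=
      Finset.sum_le_sum fun k _ => Finset.sum_le_sum fun κ _ =>
        mul_le_mul_of_nonneg_right (Povm.prob_le_trace _ (norm_copies hd T k) κ) (exp_pos _).le
    have h2 : ∀ σ : Signature S d s, ∑ k : Fin d → Bool with sign k s = σ,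
        ∑ κ : Signature S d t, ((A (sign k s)).effect κ).trace.re * exp (g k κ) ≤
        ∑ k : Fin d → Bool with sign k s = σ, d ^ T * K := by
      intro σ
      have e : ∀ k ∈ Finset.univ.filter (fun k : Fin d → Bool => sign k s = σ),
          ∑ κ : Signature S d t, ((A (sign k s)).effect κ).trace.re * exp (g k κ) =
          ∑ κ : Signature S d t, ((A σ).effect κ).trace.re * exp (g k κ) := fun k hk => by
        rw [(Finset.mem_filter.mp hk).2]
      rw [Finset.sum_congr rfl e, Finset.sum_comm, Finset.sum_const, card_fibre, nsmul_eq_mul]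
      calc ∑ κ, ∑ k : Fin d → Bool with sign k s = σ, ((A σ).effect κ).trace.re * exp (g k κ)
          ≤ ∑ κ, ((A σ).effect κ).trace.re * (2 ^ (hidden S d s).card * K) := by
            refine Finset.sum_le_sum fun κ _ => ?_
            rw [← Finset.mul_sum]
            exact mul_le_mul_of_nonneg_left (hg σ κ)
              (Complex.nonneg_iff.mp ((A σ).posSemidef κ).trace_nonneg).1
        _ = _ := by
            rw [← Finset.sum_mul, Povm.sum_trace]
            simp only [Fintype.card_fun, Fintype.card_fin]
            push_cast
            ring
    have h3 := Finset.sum_le_sum fun (σ : Signature S d s) (_ : σ ∈ Finset.univ) => h2 σ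
    rw [Finset.sum_fiberwise, Finset.sum_fiberwise] at h3
    rw [mean, one_div, inv_mul_le_iff₀ (by positivity)]
    refine h1.trans (h3.trans_eq ?_)
    simp
  -- Jensen for the joint law of key and forgery.
  have := exp_weighted_le Finset.univ
    (fun x : (Fin d → Bool) × Signature S d t =>
      1 / 2 ^ d * (A (sign x.1 s)).prob (copies T x.1) x.2) (fun x => g x.1 x.2)
    (fun x _ => mul_nonneg (by positivity) (Povm.prob_nonneg _ _ _))
    (by simpa only [mul_one, mean_const A hd] using (hmean fun _ _ => 1).symm)
    (K := d ^ T * K) (by positivity) ((hmean _).symm.trans_le hexp)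
  rw [log_mul (by positivity) hK.ne', log_pow] at this
  rw [hmean]
  exact this

lemma one_sub_errorProb (hd : 0 < d) :
    1 - errorProb A = mean A fun k κ => probOne t κ k := by
  have h1 : errorProb A = mean A fun k κ => 1 + (-1) * probOne t κ k := by
    simp only [errorProb, mean, probZero]
    ring_nf
  rw [h1, mean_add, mean_mul, mean_const A hd]
  ring

end Mean

/-! ### Splitting the correlation into known and hidden parts -/

/-- The contribution of the positions hidden by `s` to the correlation. -/
noncomputable def hiddenCorr (s t : Fin S) (κ : Signature S d t) (k : Fin d → Bool) : ℝ :=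
  ∑ j ∈ hidden S d s, signVector t κ j * chi (k j)

/-- The contribution of the positions revealed by `s` to the correlation. -/
noncomputable def knownCorr (s t : Fin S) (κ : Signature S d t) (k : Fin d → Bool) : ℝ :=
  ∑ j ∈ (hidden S d s)ᶜ, signVector t κ j * chi (k j)

lemma corr_eq_add (s t : Fin S) (κ : Signature S d t) (k : Fin d → Bool) :
    corr t κ k = knownCorr s t κ k + hiddenCorr s t κ k :=
  (Finset.sum_compl_add_sum _ _).symm

lemma knownCorr_congr {s t : Fin S} {κ : Signature S d t} {k k' : Fin d → Bool}
    (h : sign k s = sign k' s) : knownCorr s t κ k = knownCorr s t κ k' := by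
  refine Finset.sum_congr rfl fun j hj => ?_
  have : k j = k' j := congrFun h ⟨j, Finset.mem_compl.mp hj⟩
  rw [this]

lemma signVector_sq_of_mem {s t : Fin S} (hst : t ≠ s) (κ : Signature S d t) :
    ∀ j ∈ hidden S d s, signVector t κ j ^ 2 = 1 := fun _ hj =>
  signVector_sq t κ (Finset.disjoint_left.mp (disjoint_hidden hst) hj)

lemma abs_hiddenCorr_le {s t : Fin S} (hst : t ≠ s) (κ : Signature S d t) (k : Fin d → Bool) :
    |hiddenCorr s t κ k| ≤ (hidden S d s).card := by
  refine (Finset.abs_sum_le_sum_abs _ _).trans ((Finset.sum_le_card_nsmul _ _ 1 ?_).trans_eq ?_)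
  · intro j hj
    rw [← sq_le_one_iff_abs_le_one, mul_pow, chi_sq, signVector_sq_of_mem hst κ j hj, mul_one]
  · simp

/-- Only positions outside both blocks contribute, each at most 1 in absolute value. -/
lemma abs_knownCorr_le {s t : Fin S} (hst : t ≠ s) (κ : Signature S d t) (k : Fin d → Bool) :
    |knownCorr s t κ k| ≤ (hidden S d t)ᶜ.card - (hidden S d s).card := by
  have h1 := sum_signVector_sq t κ
  rw [← Finset.sum_compl_add_sum (hidden S d s),
    Finset.sum_congr (s₁ := hidden S d s) rfl (signVector_sq_of_mem hst κ)] at h1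
  have h2 : |knownCorr s t κ k| ≤ ∑ j ∈ (hidden S d s)ᶜ, signVector t κ j ^ 2 := by
    refine (Finset.abs_sum_le_sum_abs _ _).trans (Finset.sum_le_sum fun j _ => ?_)
    by_cases hj : j ∈ hidden S d t
    · simp [signVector, hj]
    · rw [signVector_sq t κ hj, ← sq_le_one_iff_abs_le_one, mul_pow, chi_sq, signVector_sq t κ hj,
        mul_one]
  simp only [Finset.sum_const, nsmul_eq_mul, mul_one] at h1
  linarith

/-! ### The two moment bounds -/

section Moments

variable {T m : ℕ} {s t : Fin S} (A : Attack S d T s t) {w : ℝ}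

lemma mean_mul_hiddenCorr_le (hd : 0 < d) (hst : t ≠ s) (hm : (hidden S d s).card = m)
    (h₀ : 0 ≤ w) (h₁ : w ≤ 1) (hw : T * log d = m * rate w) {B : ℝ}
    (hB : B = (hidden S d t)ᶜ.card - (hidden S d s).card) :
    mean A (fun k κ => knownCorr s t κ k * hiddenCorr s t κ k) ≤ B * (m * w) := by
  set E := mean A (fun k κ => knownCorr s t κ k * hiddenCorr s t κ k) with hE
  have ha : ∀ κ k, |knownCorr s t κ k| ≤ B := fun κ k => hB ▸ abs_knownCorr_le hst κ k
  have hB0 : 0 ≤ B := (abs_nonneg _).trans (ha (fun _ => false) fun _ => false)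
  have htriv : E ≤ B * m := by
    rw [← mean_const A hd (B * m)]
    refine mean_mono A fun k κ => (le_abs_self _).trans ?_
    rw [abs_mul]
    exact mul_le_mul (ha κ k) (hm ▸ abs_hiddenCorr_le hst κ k) (abs_nonneg _) hB0
  -- At w = 1 the dual variable artanh w is infinite, but the trivial bound is already the claim.
  rcases h₁.eq_or_lt with rfl | h₁
  · simpa using htriv
  rcases hB0.eq_or_lt with hB1 | hB1
  · rw [← hB1] at htriv ⊢
    simpa using htriv
  have key : ∀ r : ℝ, r * E ≤ m * rate w + m * log (cosh (r * B)) := by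
    intro r
    rw [hE, ← mean_mul, ← hw, ← log_pow (cosh (r * B))]
    refine mean_le_log A hd (pow_pos (cosh_pos _) _) fun σ κ => ?_
    rcases (Finset.univ.filter fun k : Fin d → Bool => sign k s = σ).eq_empty_or_nonempty with
      he | ⟨k₀, hk₀⟩
    · rw [he, Finset.sum_empty]
      have := cosh_pos (r * B)
      positivity
    -- The known part is constant on a fibre, so it only rescales the dual variable.
    have e : ∀ k ∈ Finset.univ.filter (fun k : Fin d → Bool => sign k s = σ),
        exp (r * (knownCorr s t κ k * hiddenCorr s t κ k)) =
          exp ((r * knownCorr s t κ k₀) *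
            ∑ j ∈ hidden S d s, signVector t κ j * chi (k j)) := fun k hk => by
      rw [knownCorr_congr (((Finset.mem_filter.mp hk).2).trans (Finset.mem_filter.mp hk₀).2.symm),
        mul_assoc, hiddenCorr]
    rw [Finset.sum_congr rfl e, sum_fibre_exp σ (signVector_sq_of_mem hst κ), hm]
    refine mul_le_mul_of_nonneg_left (pow_le_pow_left₀ (cosh_pos _).le ?_ _) (by positivity)
    rw [cosh_le_cosh, abs_mul, abs_mul, abs_of_nonneg hB0]
    exact mul_le_mul_of_nonneg_left (ha κ k₀) (abs_nonneg r)
  -- At w = 0 the optimal r is 0 and `key` says nothing; small r > 0 is used instead, through log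
  -- cosh u ≤ u²/2.
  rcases h₀.eq_or_lt with rfl | h₀
  · rw [mul_zero, mul_zero]
    by_contra! hpos
    have hr : ∀ r : ℝ, 0 < r → E ≤ r * (m * B ^ 2 / 2) := by
      intro r hr
      have h1 := key r
      have h2 : log (cosh (r * B)) ≤ (r * B) ^ 2 / 2 := by
        rw [log_le_iff_le_exp (cosh_pos _)]
        exact cosh_le_exp_half_sq _
      rw [rate_zero, mul_zero, zero_add] at h1
      have h3 := h1.trans (mul_le_mul_of_nonneg_left h2 (Nat.cast_nonneg m))
      rw [← mul_le_mul_iff_right₀ hr]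
      linarith
    have hC : 0 ≤ m * B ^ 2 / 2 := by positivity
    -- With C = mB²/2, this r gives E ≤ E·C/(2(C + 1)), impossible for E > 0.
    have h1 := hr (E / (m * B ^ 2 / 2 + 1) / 2) (by positivity)
    rw [div_div, div_mul_eq_mul_div, le_div_iff₀ (by positivity)] at h1
    nlinarith
  -- The optimal r: by duality the `rate w` terms cancel.
  · have h1 := key (slope w / B)
    have hs : 0 < slope w := h₀.trans_le (le_slope h₀.le h₁)
    rw [div_mul_cancel₀ _ hB1.ne', log_cosh_slope (by linarith) h₁, div_mul_eq_mul_div,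
      div_le_iff₀ hB1] at h1
    rw [← mul_le_mul_iff_right₀ hs]
    linarith

lemma mean_hiddenCorr_sq_le (hd : 0 < d) (hst : t ≠ s) (hm : (hidden S d s).card = m)
    (hm0 : 0 < m) (h₀ : 0 ≤ w) (h₁ : w ≤ 1) (hw : T * log d = m * rate w) :
    mean A (fun k κ => hiddenCorr s t κ k ^ 2) ≤ (m * w) ^ 2 + m * (2 * log (m + 1)) := by
  have hm' : (0 : ℝ) < m := by exact_mod_cast hm0
  have hb : ∀ κ k, |hiddenCorr s t κ k| ≤ m := fun κ k => hm ▸ abs_hiddenCorr_le hst κ k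
  have hlog : 0 ≤ log ((m : ℝ) + 1) := log_nonneg (by linarith)
  rcases h₁.eq_or_lt with rfl | h₁
  · have : mean A (fun k κ => hiddenCorr s t κ k ^ 2) ≤ (m : ℝ) ^ 2 := by
      rw [← mean_const A hd ((m : ℝ) ^ 2)]
      exact mean_mono A fun k κ => sq_le_sq.mpr (by rw [abs_of_pos hm']; exact hb κ k)
    rw [mul_one]
    have := mul_nonneg hm'.le hlog
    linarith
  obtain ⟨c, hc, htan⟩ := exists_rate_tangent h₀ h₁
  have hle : mean A (fun k κ => m * rate (|hiddenCorr s t κ k| / m)) ≤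
      m * rate w + log (m + 1) := by
    rw [← hw]
    refine mean_le_log A hd (by positivity) fun σ κ => ?_
    rw [hm]
    exact sum_fibre_exp_rate σ hm0 hm (signVector_sq_of_mem hst κ)
  have hge : m * rate w - m * c * w ^ 2 + c / m * mean A (fun k κ => hiddenCorr s t κ k ^ 2) ≤
      mean A (fun k κ => m * rate (|hiddenCorr s t κ k| / m)) := by
    rw [← mean_const A hd (m * rate w - m * c * w ^ 2), ← mean_mul, ← mean_add]
    refine mean_mono A fun k κ => ?_
    have h1 := mul_le_mul_of_nonneg_left (htan (|hiddenCorr s t κ k| / m) (by positivity)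
      (by rw [div_le_one hm']; exact hb κ k)) hm'.le
    refine le_trans (le_of_eq ?_) h1
    rw [div_pow, sq_abs]
    field_simp
    ring
  set E := mean A (fun k κ => hiddenCorr s t κ k ^ 2)
  have h1 : c / m * E ≤ m * c * w ^ 2 + log (m + 1) := by linarith
  have hc0 : 0 < c := by linarith
  have h2 : E ≤ (m * w) ^ 2 + m * log (m + 1) / c := by
    have : E = m / c * (c / m * E) := by field_simp
    rw [this]
    refine (mul_le_mul_of_nonneg_left h1 (by positivity)).trans_eq ?_
    field_simp
  -- The tangent slope satisfies c ≥ 1/2, whence the factor 2.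
  have h3 : m * log ((m : ℝ) + 1) / c ≤ m * (2 * log (m + 1)) := by
    rw [div_le_iff₀ hc0]
    have := mul_nonneg hm'.le hlog
    nlinarith
  linarith

end Moments

end QSig

/-! ### Assembling the bound -/

open Real QSig

theorem proposition1 (S d T : ℕ) (hd : 0 < d) (hSd : S ∣ d)
    (hφ : QSig.phi d T ≤ QSig.alpha S) (s t : Fin S) (hst : t ≠ s)
    (A : QSig.Attack S d T s t) :
    1 - QSig.errorProb A ≤ QSig.p1 S d T := by
  obtain ⟨m, rfl⟩ := hSd
  have hS : 2 ≤ S := by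
    have := Fin.val_ne_of_ne hst
    omega
  have hm : 0 < m := Nat.pos_of_mul_pos_left hd
  have hS' : (2 : ℝ) ≤ S := by exact_mod_cast hS
  have hm' : (1 : ℝ) ≤ m := by exact_mod_cast hm
  have hdiv : S * m / S = m := Nat.mul_div_cancel_left m (by omega)
  have hmle : m ≤ S * m := Nat.le_mul_of_pos_left m (by omega)
  have hcs : (hidden S (S * m) s).card = m := (card_hidden (dvd_mul_right S m) s).trans hdiv
  have hct : (hidden S (S * m) t).card = m := (card_hidden (dvd_mul_right S m) t).trans hdiv
  set ℓ : ℝ := S * m - m with hℓ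
  have hcc : ((hidden S (S * m) t)ᶜ.card : ℝ) = ℓ := by
    rw [Finset.card_compl, hct, Fintype.card_fin, Nat.cast_sub hmle, Nat.cast_mul]
  have hrl : (revealedLength S (S * m) : ℝ) = ℓ := by
    rw [revealedLength, hdiv, Nat.cast_sub hmle, Nat.cast_mul]
  have hmℓ : (m : ℝ) ≤ ℓ := by rw [hℓ]; nlinarith
  have hℓ0 : 0 < ℓ := by linarith
  have hlogd : 0 ≤ logb 2 ((S * m : ℕ) : ℝ) :=
    logb_nonneg one_lt_two (by exact_mod_cast hd)
  have hα : 0 < alpha S := by rw [alpha]; positivity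
  have hratio0 : 0 ≤ phi (S * m) T / alpha S := by
    refine div_nonneg ?_ hα.le
    rw [phi]
    positivity
  have hratio1 : phi (S * m) T / alpha S ≤ 1 := (div_le_one hα).mpr hφ
  obtain ⟨⟨hx0, hx1⟩, hx⟩ := hInv_spec (sub_nonneg.mpr hratio1) (sub_le_self 1 hratio0)
  set x := hInv (1 - phi (S * m) T / alpha S) with hxdef
  -- Since φ/α = T log₂ d / m, the equation h(x) = 1 - φ/α says exactly that w = 1 - 2x has the rate
  -- the moment bounds require.
  have hrate : T * log ((S * m : ℕ) : ℝ) = m * rate (1 - 2 * x) := by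
    have l2 : log 2 ≠ 0 := (log_pos one_lt_two).ne'
    rw [rate, show (1 - (1 - 2 * x)) / 2 = x by ring, ← h_mul_log_two, hx, phi, alpha, logb]
    push_cast
    field_simp
    ring
  have hab := mean_mul_hiddenCorr_le A hd hst hcs (by linarith) (by linarith) hrate rfl
  have hbb := mean_hiddenCorr_sq_le A hd hst hcs hm (by linarith) (by linarith) hrate
  rw [hcc, hcs] at hab
  have hcorr : mean A (fun k κ => corr t κ k ^ 2) ≤
      (ℓ - m) ^ 2 + 2 * mean A (fun k κ => knownCorr s t κ k * hiddenCorr s t κ k) +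
        mean A fun k κ => hiddenCorr s t κ k ^ 2 := by
    rw [← mean_mul, ← mean_const A hd ((ℓ - m) ^ 2), ← mean_add, ← mean_add]
    refine mean_mono A fun k κ => ?_
    have h1 := abs_knownCorr_le hst κ k
    rw [hcc, hcs] at h1
    have h2 := sq_le_sq' (abs_le.mp h1).1 (abs_le.mp h1).2
    rw [corr_eq_add s t κ k]
    linarith
  -- The spare factor m is enlarged to ℓ, which S ≥ 2 permits, to match the shape of `p1`.
  have hlog : m * (2 * log (m + 1)) ≤ √(8 / 3) * √m * ℓ := by
    have h1 := two_mul_log_succ_le m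
    rw [mul_comm]
    exact mul_le_mul h1 hmℓ (by linarith) (by positivity)
  have hacc : 1 - errorProb A =
      1 / ((S * m : ℕ) * ℓ) * mean A fun k κ => corr t κ k ^ 2 := by
    rw [one_sub_errorProb A hd, ← mean_mul]
    congr 1
    funext k κ
    rw [probOne_eq hd, hcc]
    ring
  have hp : p1 S (S * m) T = 1 / ((S * m : ℕ) * ℓ) *
      ((ℓ - m + m * (1 - 2 * x)) ^ 2 + √(8 / 3) * √m * ℓ) := by
    have h1 : 1 - alpha S = ℓ / (S * m) := by
      rw [alpha, hℓ]
      field_simp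
    have h2 : alpha S / (1 - alpha S) = m / ℓ := by
      rw [h1, alpha]
      field_simp
    have h3 : ((S * m : ℕ) : ℝ) - ℓ = m := by rw [hℓ]; push_cast; ring
    rw [p1, ← hxdef, h2, h1, hrl, h3]
    push_cast
    field_simp
    ring
  rw [hacc, hp]
  refine mul_le_mul_of_nonneg_left ?_ (by positivity)
  linarith
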